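/- Let a binary rate-$1/2$ recursive systematic convolutional encoder be given by its generator $(1, n(D)/d(D))$, where $n,d\in\mathbb F_2[D]$, $d(0)=1$ and $n/d$ is not a polynomial. Let $f_{\mathrm s}(x,y)$ be the transfer function of its optimal bitwise (BCJR) decoder for information bits on the erasure channel: the limit, as the block length tends to infinity, of the average extrinsic erasure probability of an information bit when information bits are erased independently with probability $x$ and parity bits independently with probability $y$. Let $q\ge 1$ be an integer (repetition factor), $\lambda\in[0,1/q]$ (repetition ratio) and $\rho\in[0,1]$ (fraction of surviving parity bits). For $x,\epsilon\in[0,1]$ define $$f(x;\epsilon)=f_{\mathrm s}\bigl(\epsilon x,\,1-(1-\epsilon)\rho\bigr),\qquad g(x)=q\lambda x^{2q-1}+(1-q\lambda)x,$$ $$F(x;\epsilon)=\int_0^x f(z;\epsilon)\,dz,\qquad G(x)=\int_0^x g(z)\,dz,\qquad U(x;\epsilon)=x\,g(x)-G(x)-F(g(x);\epsilon),$$ $$u(\epsilon)=\sup\{\tilde x\in[0,1]: f(g(x);\epsilon)<x \text{ for all } x\in(0,\tilde x)\},$$ and the potential threshold $$\epsilon_{\mathrm c}=\sup\Bigl\{\epsilon\in[0,1]:\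 \min_{x\in[u(\epsilon),1]}U(x;\epsilon)\ge 0,\ u(\epsilon)>0\Bigr\}.$$ (In this statement the supremum of the empty set is read as $0$.) For coupling memory $m$ and coupling length $L$, the density evolution recursion of the generalized spatially coupled parallel concatenated code with identical upper and lower component encoders is $$x_t^{(\ell)}=\frac1{1+m}\sum_{j=0}^m f\Bigl(\frac1{1+m}\sum_{k=0}^m g\bigl(x^{(\ell-1)}_{t+j-k}\bigr);\epsilon\Bigr),\qquad t=1,\dots,L,$$ with $x_t^{(\ell)}=0$ for $t\le 0$ and $t>L$. Theorem (threshold saturation). Let $\epsilon\in[0,1]$ with $\epsilon<\epsilon_{\mathrm c}$. Then there is an $m_0$ (depending on $\epsilon$ and on the ensemble parameters, but not on $L$) such that for every $m\ge m_0$ and every coupling length $L$, the only fixed point of the recursion with all $x_t\in[0,1]$ is $\boldsymbol x=\boldsymbol 0$. -/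

import Mathlib

/-! ### Recursive systematic convolutional codes of rate `1/2` -/

/-- A binary rate-`1/2` recursive systematic convolutional encoder with generator
`(1, num(D) / den(D))`. The condition `den(0) = 1` makes the encoder causal; "recursive" means that
the parity response to a single information bit is infinite, i.e. that `num / den` is not a
polynomial. -/
structure RSCEncoder where
  num : Polynomial (ZMod 2)
  den : Polynomial (ZMod 2)
  den_coeff_zero : den.coeff 0 = 1
  recursive : ¬ den ∣ num

namespace RSCEncoder

noncomputable section

/-- The impulse response `num(D) / den(D)` of the parity output, as a power series in `D`. -/
def impulse (E : RSCEncoder) : PowerSeries (ZMod 2) :=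
  (E.num : PowerSeries (ZMod 2)) * (E.den : PowerSeries (ZMod 2))⁻¹

/-- Parity bit at time `t` of the information block `u` of length `N` (encoder started in the zero
state): the coefficient of `D ^ t` in `(num(D) / den(D)) * u(D)`. -/
def parity (E : RSCEncoder) {N : ℕ} (u : Fin N → ZMod 2) (t : Fin N) : ZMod 2 :=
  ∑ i ∈ Finset.univ.filter (fun i : Fin N => i ≤ t),
    PowerSeries.coeff ((t : ℕ) - (i : ℕ)) E.impulse * u i

/-- Extrinsic recoverability on the erasure channel. The information bits at the positions in `A`
and the parity bits at the positions in `B` are erased, and the channel value of the information bit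
at time `t` itself is not used. The bit at time `t` is recovered by the optimal bitwise decoder
(BCJR) if and only if all codewords that agree on the remaining known positions agree at that
bit. -/
def ExtrinsicRecoverable (E : RSCEncoder) {N : ℕ} (A B : Finset (Fin N)) (t : Fin N) : Prop :=
  ∀ u v : Fin N → ZMod 2,
    (∀ i, i ≠ t → i ∉ A → u i = v i) →
    (∀ i, i ∉ B → E.parity u i = E.parity v i) →
    u t = v t

open Classical in
/-- Average over the positions of a block of length `N` of the probability that the extrinsic output
for an information bit is an erasure, when information bits are erased independently with
probability `x` and parity bits independently with probability `y`. -/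
def blockErasure (E : RSCEncoder) (N : ℕ) (x y : ℝ) : ℝ :=
  (1 / (N : ℝ)) * ∑ t : Fin N, ∑ A : Finset (Fin N), ∑ B : Finset (Fin N),
    if E.ExtrinsicRecoverable A B t then 0
    else x ^ A.card * (1 - x) ^ (N - A.card) * (y ^ B.card * (1 - y) ^ (N - B.card))

/-- The transfer function `f_s(x, y)` of the decoder for the information bits: the limit of the
average extrinsic erasure probability as the block length tends to infinity (written as an upper
limit, which is the limit where the limit exists). -/
def transfer (E : RSCEncoder) (x y : ℝ) : ℝ :=
  Filter.limsup (fun N : ℕ => E.blockErasure N x y) Filter.atTop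

end

end RSCEncoder

/-! ### Density evolution, potential function and potential threshold -/

namespace GSCPCC

noncomputable section

/-- `f(x; ε) = f_s(ε x, 1 - (1 - ε) ρ)`, with `ρ` the fraction of surviving parity bits. -/
def f (E : RSCEncoder) (ρ : ℝ) (x ε : ℝ) : ℝ :=
  E.transfer (ε * x) (1 - (1 - ε) * ρ)

/-- `g(x) = q λ x ^ (2 q - 1) + (1 - q λ) x`, with repetition factor `q` and repetition
ratio `lam`. -/
def g (q : ℕ) (lam : ℝ) (x : ℝ) : ℝ :=
  q * lam * x ^ (2 * q - 1) + (1 - q * lam) * x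

/-- `F(x; ε) = ∫₀ˣ f(z; ε) dz`. -/
def F (E : RSCEncoder) (ρ : ℝ) (x ε : ℝ) : ℝ :=
  ∫ z in (0 : ℝ)..x, f E ρ z ε

/-- `G(x) = ∫₀ˣ g(z) dz`. -/
def G (q : ℕ) (lam : ℝ) (x : ℝ) : ℝ :=
  ∫ z in (0 : ℝ)..x, g q lam z

/-- The potential function `U(x; ε) = x g(x) - G(x) - F(g(x); ε)` of the uncoupled ensemble. -/
def U (E : RSCEncoder) (q : ℕ) (lam ρ : ℝ) (x ε : ℝ) : ℝ :=
  x * g q lam x - G q lam x - F E ρ (g q lam x) ε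

/-- `u(ε) = sup {x' ∈ [0, 1] : f(g(x); ε) < x for all x ∈ (0, x')}`. -/
def minUnstable (E : RSCEncoder) (q : ℕ) (lam ρ : ℝ) (ε : ℝ) : ℝ :=
  sSup {x' : ℝ | x' ∈ Set.Icc (0 : ℝ) 1 ∧ ∀ x ∈ Set.Ioo 0 x', f E ρ (g q lam x) ε < x}

/-- The potential threshold
`ε_c = sup {ε ∈ [0, 1] : min_{x ∈ [u(ε), 1]} U(x; ε) ≥ 0 and u(ε) > 0}`. -/
def potentialThreshold (E : RSCEncoder) (q : ℕ) (lam ρ : ℝ) : ℝ :=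
  sSup {ε : ℝ | ε ∈ Set.Icc (0 : ℝ) 1 ∧
    (∀ x ∈ Set.Icc (minUnstable E q lam ρ ε) 1, 0 ≤ U E q lam ρ x ε) ∧
    0 < minUnstable E q lam ρ ε}

/-- One step of the density evolution recursion of the coupled ensemble with coupling memory `m` and
coupling length `L`. The erasure probabilities are indexed by time `t`; the information bits at the
times `t ≤ 0` and `t > L` are known zeros, so that the erasure probability there is `0`. -/
def coupledStep (E : RSCEncoder) (q : ℕ) (lam ρ ε : ℝ) (m L : ℕ) (x : ℤ → ℝ) (t : ℤ) : ℝ :=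
  if 1 ≤ t ∧ t ≤ (L : ℤ) then
    (1 / ((m : ℝ) + 1)) * ∑ j ∈ Finset.range (m + 1),
      f E ρ ((1 / ((m : ℝ) + 1)) * ∑ k ∈ Finset.range (m + 1),
        g q lam (x (t + (j : ℤ) - (k : ℤ)))) ε
  else 0

end

end GSCPCC

open Set Filter Topology

/-! ### Monotonicity of the transfer function -/

/-! The only facts used about the transfer function are that it is monotone in both arguments and
takes values in [0,1]; neither its continuity nor a closed form is needed.

Upper bound on the potential: the running maximum of a fixed point is a monotone subsolution of the
coupled recursion. Summing its increments by parts, with the forward average being the adjoint of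
the backward one, compares the potential at the maximum `M` with 0. The discretization costs one
shift of the forward window, hence at most `1 / (m + 1)` whatever `L` is
(`exists_le_scalarPotential_le`).

Lower bound: choose `ε' > ε` in the set defining the threshold. Lowering `ε'` to `ε` is at least as
good as shrinking the argument of `f` by some `s < 1`. Since the primitive of a monotone function is
convex, this makes the potential strictly positive on `[u(ε'), 1]` (`scalarPotential_pos`). By
compactness it has a positive minimum there, and `m₀` is chosen with `1 / (m₀ + 1)` below that
minimum.

Finally `M ≤ f (g M)` excludes `0 < M < u(ε')`, so only `M = 0` remains. -/

theorem Finset.sum_powerset_bernoulli_insert {α : Type*} [DecidableEq α] {a : α} {s : Finset α}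
    (ha : a ∉ s) (φ : Finset α → ℝ) (x : ℝ) :
    ∑ A ∈ (insert a s).powerset, φ A * (x ^ A.card * (1 - x) ^ ((insert a s).card - A.card)) =
      (1 - x) * ∑ A ∈ s.powerset, φ A * (x ^ A.card * (1 - x) ^ (s.card - A.card)) +
        x * ∑ A ∈ s.powerset, φ (insert a A) * (x ^ A.card * (1 - x) ^ (s.card - A.card)) := by
  rw [Finset.sum_powerset_insert ha, Finset.mul_sum, Finset.mul_sum, Finset.card_insert_of_notMem ha]
  congr 1
  · refine Finset.sum_congr rfl fun A hA => ?_
    have hle := Finset.card_le_card (Finset.mem_powerset.1 hA)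
    rw [Nat.succ_sub hle, pow_succ]
    ring
  · refine Finset.sum_congr rfl fun A hA => ?_
    have hA' : a ∉ A := fun h => ha (Finset.mem_powerset.1 hA h)
    rw [Finset.card_insert_of_notMem hA', Nat.succ_sub_succ, pow_succ]
    ring

/-- Induction on the ground set, conditioning on whether the new element is erased: raising its
erasure probability moves weight to the larger of two averages. -/
theorem Finset.sum_powerset_bernoulli_mono {α : Type*} [DecidableEq α] (s : Finset α)
    {φ ψ : Finset α → ℝ} (hφ : Monotone φ) (hle : ∀ A, φ A ≤ ψ A)
    {x x' : ℝ} (hx : 0 ≤ x) (hxx' : x ≤ x') (hx' : x' ≤ 1) :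
    ∑ A ∈ s.powerset, φ A * (x ^ A.card * (1 - x) ^ (s.card - A.card)) ≤
      ∑ A ∈ s.powerset, ψ A * (x' ^ A.card * (1 - x') ^ (s.card - A.card)) := by
  -- Pass from `φ` to `ψ` at the parameter `x'`, so that only `x` varies in the induction.
  refine le_trans ?_ (Finset.sum_le_sum (f := fun A => φ A * (x' ^ A.card * (1 - x') ^ (s.card - A.card)))
    fun A _ => mul_le_mul_of_nonneg_right (hle A)
      (mul_nonneg (pow_nonneg (hx.trans hxx') _) (pow_nonneg (by linarith) _)))
  clear hle ψ
  induction s using Finset.induction_on generalizing φ with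
  | empty => simp
  | insert a s ha ih =>
    rw [Finset.sum_powerset_bernoulli_insert ha, Finset.sum_powerset_bernoulli_insert ha]
    have h1 := ih hφ
    have h2 := ih (φ := fun A => φ (insert a A)) fun A B h => hφ (Finset.insert_subset_insert a h)
    have h3 : ∑ A ∈ s.powerset, φ A * (x ^ A.card * (1 - x) ^ (s.card - A.card)) ≤
        ∑ A ∈ s.powerset, φ (insert a A) * (x ^ A.card * (1 - x) ^ (s.card - A.card)) :=
      Finset.sum_le_sum fun A _ => mul_le_mul_of_nonneg_right (hφ (Finset.subset_insert a A))
        (mul_nonneg (pow_nonneg hx _) (pow_nonneg (by linarith) _))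
    nlinarith [mul_le_mul_of_nonneg_left h1 (sub_nonneg.2 hx'),
      mul_le_mul_of_nonneg_left h2 (hx.trans hxx'),
      mul_nonneg (sub_nonneg.2 hxx') (sub_nonneg.2 h3)]

theorem sum_bernoulli_mono {n : ℕ} {φ ψ : Finset (Fin n) → ℝ} (hφ : Monotone φ)
    (hle : ∀ A, φ A ≤ ψ A) {x x' : ℝ} (hx : 0 ≤ x) (hxx' : x ≤ x') (hx' : x' ≤ 1) :
    ∑ A, φ A * (x ^ A.card * (1 - x) ^ (n - A.card)) ≤
      ∑ A, ψ A * (x' ^ A.card * (1 - x') ^ (n - A.card)) := by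
  simpa using Finset.sum_powerset_bernoulli_mono Finset.univ hφ hle hx hxx' hx'

theorem sum_bernoulli_mem_Icc {n : ℕ} {φ : Finset (Fin n) → ℝ} (hφ : ∀ A, φ A ∈ Icc (0 : ℝ) 1)
    {x : ℝ} (hx : x ∈ Icc (0 : ℝ) 1) :
    ∑ A, φ A * (x ^ A.card * (1 - x) ^ (n - A.card)) ∈ Icc (0 : ℝ) 1 := by
  have hw : ∀ A : Finset (Fin n), 0 ≤ x ^ A.card * (1 - x) ^ (n - A.card) := fun A =>
    mul_nonneg (pow_nonneg hx.1 _) (pow_nonneg (sub_nonneg.2 hx.2) _)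
  refine ⟨Finset.sum_nonneg fun A _ => mul_nonneg (hφ A).1 (hw A), ?_⟩
  calc ∑ A, φ A * (x ^ A.card * (1 - x) ^ (n - A.card))
      ≤ ∑ A : Finset (Fin n), x ^ A.card * (1 - x) ^ (n - A.card) :=
        Finset.sum_le_sum fun A _ => mul_le_of_le_one_left (hw A) (hφ A).2
    _ = 1 := by
        have := Fintype.sum_pow_mul_eq_add_pow (Fin n) x (1 - x)
        simpa using this

namespace RSCEncoder

open Classical in
/-- The indicator of the event that the extrinsic output at time `t` is an erasure. -/
noncomputable def erasureIndicator (E : RSCEncoder) {N : ℕ} (t : Fin N) (A B : Finset (Fin N)) : ℝ :=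
  if E.ExtrinsicRecoverable A B t then 0 else 1

theorem erasureIndicator_mem_Icc (E : RSCEncoder) {N : ℕ} (t : Fin N) (A B : Finset (Fin N)) :
    E.erasureIndicator t A B ∈ Icc (0 : ℝ) 1 := by
  unfold erasureIndicator
  split_ifs <;> simp

theorem erasureIndicator_mono (E : RSCEncoder) {N : ℕ} (t : Fin N) {A A' B B' : Finset (Fin N)}
    (hA : A ⊆ A') (hB : B ⊆ B') : E.erasureIndicator t A B ≤ E.erasureIndicator t A' B' := by
  by_cases h : E.ExtrinsicRecoverable A' B' t
  · have h' : E.ExtrinsicRecoverable A B t := fun u v h1 h2 =>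
      h u v (fun i hi hiA => h1 i hi fun h => hiA (hA h)) fun i hi => h2 i fun h => hi (hB h)
    simp [erasureIndicator, h, h']
  · have h1 : E.erasureIndicator t A' B' = 1 := by simp [erasureIndicator, h]
    rw [h1]
    exact (E.erasureIndicator_mem_Icc t A B).2

theorem blockErasure_eq (E : RSCEncoder) (N : ℕ) (x y : ℝ) :
    E.blockErasure N x y = (1 / (N : ℝ)) * ∑ t : Fin N, ∑ A : Finset (Fin N),
      (∑ B : Finset (Fin N), E.erasureIndicator t A B * (y ^ B.card * (1 - y) ^ (N - B.card))) *
        (x ^ A.card * (1 - x) ^ (N - A.card)) := by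
  unfold blockErasure
  congr 1
  refine Finset.sum_congr rfl fun t _ => Finset.sum_congr rfl fun A _ => ?_
  rw [Finset.sum_mul]
  refine Finset.sum_congr rfl fun B _ => ?_
  unfold erasureIndicator
  split_ifs
  · ring
  · ring

theorem blockErasure_mem_Icc (E : RSCEncoder) (N : ℕ) {x y : ℝ} (hx : x ∈ Icc (0 : ℝ) 1)
    (hy : y ∈ Icc (0 : ℝ) 1) : E.blockErasure N x y ∈ Icc (0 : ℝ) 1 := by
  rw [blockErasure_eq]
  have h := fun t : Fin N => sum_bernoulli_mem_Icc (fun A =>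
    sum_bernoulli_mem_Icc (fun B => E.erasureIndicator_mem_Icc t A B) hy) hx
  refine ⟨mul_nonneg (by positivity) (Finset.sum_nonneg fun t _ => (h t).1), ?_⟩
  rw [one_div_mul_eq_div]
  refine div_le_one_of_le₀ ?_ (Nat.cast_nonneg N)
  simpa using Finset.sum_le_sum fun (t : Fin N) (_ : t ∈ Finset.univ) => (h t).2

theorem blockErasure_mono (E : RSCEncoder) (N : ℕ) {x x' y y' : ℝ} (hx : 0 ≤ x) (hxx' : x ≤ x')
    (hx' : x' ≤ 1) (hy : 0 ≤ y) (hyy' : y ≤ y') (hy' : y' ≤ 1) :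
    E.blockErasure N x y ≤ E.blockErasure N x' y' := by
  rw [blockErasure_eq, blockErasure_eq]
  refine mul_le_mul_of_nonneg_left (Finset.sum_le_sum fun t _ => ?_) (by positivity)
  refine sum_bernoulli_mono (fun A A' hA => ?_) (fun A => ?_) hx hxx' hx'
  · exact sum_bernoulli_mono (fun B B' hB => E.erasureIndicator_mono t le_rfl hB)
      (fun B => E.erasureIndicator_mono t hA le_rfl) hy le_rfl (hyy'.trans hy')
  · exact sum_bernoulli_mono (fun B B' hB => E.erasureIndicator_mono t le_rfl hB)
      (fun B => le_rfl) hy hyy' hy'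

theorem isBoundedUnder_le_blockErasure (E : RSCEncoder) {x y : ℝ} (hx : x ∈ Icc (0 : ℝ) 1)
    (hy : y ∈ Icc (0 : ℝ) 1) :
    IsBoundedUnder (· ≤ ·) atTop fun N : ℕ => E.blockErasure N x y :=
  isBoundedUnder_of ⟨1, fun N => (E.blockErasure_mem_Icc N hx hy).2⟩

theorem isCoboundedUnder_le_blockErasure (E : RSCEncoder) {x y : ℝ} (hx : x ∈ Icc (0 : ℝ) 1)
    (hy : y ∈ Icc (0 : ℝ) 1) :
    IsCoboundedUnder (· ≤ ·) atTop fun N : ℕ => E.blockErasure N x y :=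
  (isBoundedUnder_of ⟨0, fun N => (E.blockErasure_mem_Icc N hx hy).1⟩ :
    IsBoundedUnder (· ≥ ·) atTop fun N : ℕ => E.blockErasure N x y).isCoboundedUnder_le

theorem transfer_mem_Icc (E : RSCEncoder) {x y : ℝ} (hx : x ∈ Icc (0 : ℝ) 1)
    (hy : y ∈ Icc (0 : ℝ) 1) : E.transfer x y ∈ Icc (0 : ℝ) 1 :=
  ⟨le_limsup_of_frequently_le
      (Frequently.of_forall fun N => (E.blockErasure_mem_Icc N hx hy).1)
      (E.isBoundedUnder_le_blockErasure hx hy),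
    limsup_le_of_le (E.isCoboundedUnder_le_blockErasure hx hy)
      (Eventually.of_forall fun N => (E.blockErasure_mem_Icc N hx hy).2)⟩

theorem transfer_mono (E : RSCEncoder) {x x' y y' : ℝ} (hx : 0 ≤ x) (hxx' : x ≤ x')
    (hx' : x' ≤ 1) (hy : 0 ≤ y) (hyy' : y ≤ y') (hy' : y' ≤ 1) :
    E.transfer x y ≤ E.transfer x' y' :=
  limsup_le_limsup
    (Eventually.of_forall fun N => E.blockErasure_mono N hx hxx' hx' hy hyy' hy')
    (E.isCoboundedUnder_le_blockErasure ⟨hx, hxx'.trans hx'⟩ ⟨hy, hyy'.trans hy'⟩)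
    (E.isBoundedUnder_le_blockErasure ⟨hx.trans hxx', hx'⟩ ⟨hy.trans hyy', hy'⟩)

end RSCEncoder

/-! ### Integrals of monotone functions -/

section MonotoneIntegral

variable {f : ℝ → ℝ} {a b : ℝ}

theorem MonotoneOn.intervalIntegrable_Icc_zero_one (hf : MonotoneOn f (Icc 0 1))
    (ha : a ∈ Icc (0 : ℝ) 1) (hb : b ∈ Icc (0 : ℝ) 1) :
    IntervalIntegrable f MeasureTheory.volume a b :=
  (hf.mono (uIcc_subset_Icc ha hb)).intervalIntegrable

theorem MonotoneOn.mul_sub_le_integral (hf : MonotoneOn f (Icc 0 1)) (ha : 0 ≤ a) (hab : a ≤ b)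
    (hb : b ≤ 1) : f a * (b - a) ≤ ∫ z in a..b, f z := by
  have h := intervalIntegral.integral_mono_on (f := fun _ => f a) (μ := MeasureTheory.volume) hab
    intervalIntegrable_const
    (hf.intervalIntegrable_Icc_zero_one ⟨ha, hab.trans hb⟩ ⟨ha.trans hab, hb⟩)
    fun z hz => hf ⟨ha, hab.trans hb⟩ ⟨ha.trans hz.1, hz.2.trans hb⟩ hz.1
  simpa [mul_comm] using h

theorem MonotoneOn.integral_le_mul_sub (hf : MonotoneOn f (Icc 0 1)) (ha : 0 ≤ a) (hab : a ≤ b)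
    (hb : b ≤ 1) : ∫ z in a..b, f z ≤ f b * (b - a) := by
  have h := intervalIntegral.integral_mono_on (g := fun _ => f b) (μ := MeasureTheory.volume) hab
    (hf.intervalIntegrable_Icc_zero_one ⟨ha, hab.trans hb⟩ ⟨ha.trans hab, hb⟩)
    intervalIntegrable_const
    fun z hz => hf ⟨ha.trans hz.1, hz.2.trans hb⟩ ⟨ha.trans hab, hb⟩ hz.2
  simpa [mul_comm] using h

theorem MonotoneOn.primitive_sub (hf : MonotoneOn f (Icc 0 1)) (ha : a ∈ Icc (0 : ℝ) 1)
    (hb : b ∈ Icc (0 : ℝ) 1) :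
    (∫ z in (0 : ℝ)..b, f z) - ∫ z in (0 : ℝ)..a, f z = ∫ z in a..b, f z :=
  intervalIntegral.integral_interval_sub_left
    (hf.intervalIntegrable_Icc_zero_one (by simp) hb)
    (hf.intervalIntegrable_Icc_zero_one (by simp) ha)

/-- Holds even if `f` jumps; the potential is therefore continuous although the transfer function
may not be. -/
theorem MonotoneOn.continuousOn_primitive (hf : MonotoneOn f (Icc 0 1)) :
    ContinuousOn (fun x => ∫ z in (0 : ℝ)..x, f z) (Icc 0 1) := by
  have h := intervalIntegral.continuousOn_primitive_interval (μ := MeasureTheory.volume)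
    (f := f) (a := 0) (b := 1) (by
      rw [uIcc_of_le zero_le_one]
      exact hf.integrableOn_isCompact isCompact_Icc)
  rwa [uIcc_of_le zero_le_one] at h

end MonotoneIntegral

/-! ### The scalar potential -/

section Potential

/-- The potential `x g(x) - ∫₀ˣ g - ∫₀^{g(x)} f` of the scalar recursion `x ↦ f (g x)`. -/
noncomputable def scalarPotential (f g : ℝ → ℝ) (x : ℝ) : ℝ :=
  x * g x - (∫ z in (0 : ℝ)..x, g z) - ∫ z in (0 : ℝ)..g x, f z

variable {f f₁ g : ℝ → ℝ} {s u x : ℝ}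

/-- Bounding `g` by its right endpoint value on each half of `[0, x]` already gives a strict
inequality. -/
theorem StrictMonoOn.integral_lt_mul (hg : StrictMonoOn g (Icc 0 1)) (hx : x ∈ Ioc (0 : ℝ) 1) :
    ∫ z in (0 : ℝ)..x, g z < x * g x := by
  obtain ⟨h0, h1⟩ := hx
  have hm : x / 2 ∈ Icc (0 : ℝ) 1 := ⟨by linarith, by linarith⟩
  have e := hg.monotoneOn.primitive_sub hm ⟨h0.le, h1⟩
  have e1 := hg.monotoneOn.integral_le_mul_sub le_rfl hm.1 hm.2
  have e2 := hg.monotoneOn.integral_le_mul_sub hm.1 (by linarith : x / 2 ≤ x) h1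
  have e3 := hg hm ⟨h0.le, h1⟩ (by linarith : x / 2 < x)
  nlinarith

/-- If `f₁` is monotone with right limit at most `0` at the origin, then its primitive satisfies
`F₁(s z) < s F₁(z)` unless `F₁(s z) ≤ 0`. -/
theorem MonotoneOn.primitive_scaling_nonpos (hf₁ : MonotoneOn f₁ (Icc 0 1))
    (hs : s ∈ Ioo (0 : ℝ) 1) {z : ℝ} (hz : z ∈ Ioc (0 : ℝ) 1)
    (hlim : ∀ a > 0, ∃ τ ∈ Ioo 0 (s * z), f₁ τ < a)
    (h : s * ∫ w in (0 : ℝ)..z, f₁ w ≤ ∫ w in (0 : ℝ)..s * z, f₁ w) :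
    ∫ w in (0 : ℝ)..s * z, f₁ w ≤ 0 := by
  have hsz0 : 0 < s * z := mul_pos hs.1 hz.1
  have hszz : s * z ≤ z := mul_le_of_le_one_left hz.1.le hs.2.le
  have hsz : s * z ∈ Icc (0 : ℝ) 1 := ⟨hsz0.le, hszz.trans hz.2⟩
  have hz' : z ∈ Icc (0 : ℝ) 1 := ⟨hz.1.le, hz.2⟩
  have e1 := hf₁.primitive_sub hsz hz'
  have e2 := hf₁.mul_sub_le_integral hsz.1 hszz hz.2
  -- Near-equality in the convexity bound forces `f₁` to be no larger at `s * z` than at any smaller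
  -- `τ > 0`.
  have hval : f₁ (s * z) ≤ 0 := by
    refine le_of_forall_pos_le_add fun a ha => ?_
    obtain ⟨τ, hτ, hτa⟩ := hlim a ha
    have hτ' : τ ∈ Icc (0 : ℝ) 1 := ⟨hτ.1.le, hτ.2.le.trans hsz.2⟩
    have e3 := hf₁.primitive_sub hτ' hsz
    have e4 := hf₁.integral_le_mul_sub le_rfl hτ.1.le hτ'.2
    have e5 := hf₁.integral_le_mul_sub hτ.1.le hτ.2.le hsz.2
    set I := ∫ w in (0 : ℝ)..s * z, f₁ w
    set J := ∫ w in (0 : ℝ)..z, f₁ w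
    have e6 : s * (f₁ (s * z) * (z - s * z)) ≤ (1 - s) * I := by
      nlinarith [mul_le_mul_of_nonneg_left (e2.trans e1.ge) hs.1.le]
    have e7 : f₁ (s * z) * (s * z) ≤ I := by
      have : (1 - s) * (f₁ (s * z) * (s * z)) ≤ (1 - s) * I := by linarith
      exact le_of_mul_le_mul_left this (by linarith [hs.2])
    have e8 : τ * f₁ (s * z) ≤ τ * f₁ τ := by linarith
    have e9 := le_of_mul_le_mul_left e8 hτ.1
    linarith
  have e10 := hf₁.integral_le_mul_sub le_rfl hsz.1 hsz.2
  nlinarith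

/-- Substitution gives `F(g x) ≤ s⁻¹ F₁(s g x)`. Either convexity makes this strictly less than
`F₁(g x)`, or it is at most 0 and the strict growth of `g` supplies the positivity. -/
theorem scalarPotential_pos (hf : MonotoneOn f (Icc 0 1)) (hf₁ : MonotoneOn f₁ (Icc 0 1))
    (hs : s ∈ Ioo (0 : ℝ) 1)
    (hff₁ : ∀ z ∈ Icc (0 : ℝ) 1, f z ≤ f₁ (s * z)) (hg : StrictMonoOn g (Icc 0 1)) (hg0 : g 0 = 0)
    (hgle : ∀ x ∈ Icc (0 : ℝ) 1, g x ≤ x) (hu : 0 < u) (hstable : ∀ x ∈ Ioo 0 u, f₁ (g x) < x)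
    (hx : x ∈ Ioc (0 : ℝ) 1) (hU : 0 ≤ scalarPotential f₁ g x) : 0 < scalarPotential f g x := by
  have hx' : x ∈ Icc (0 : ℝ) 1 := ⟨hx.1.le, hx.2⟩
  have hgpos : ∀ y ∈ Ioc (0 : ℝ) 1, 0 < g y := fun y hy => by
    simpa [hg0] using hg (by simp) ⟨hy.1.le, hy.2⟩ hy.1
  have hz : g x ∈ Ioc (0 : ℝ) 1 := ⟨hgpos x hx, (hgle x hx').trans hx.2⟩
  have hsz0 : 0 < s * g x := mul_pos hs.1 hz.1
  have hsz1 : s * g x ≤ 1 := (mul_le_of_le_one_left hz.1.le hs.2.le).trans hz.2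
  have hscale : ∀ w ∈ Icc (0 : ℝ) (g x), s * w ∈ Icc (0 : ℝ) 1 := fun w hw =>
    ⟨mul_nonneg hs.1.le hw.1, (mul_le_mul_of_nonneg_left hw.2 hs.1.le).trans hsz1⟩
  have hfle : ∫ w in (0 : ℝ)..g x, f w ≤ s⁻¹ * ∫ w in (0 : ℝ)..s * g x, f₁ w := by
    have h := intervalIntegral.integral_mono_on (μ := MeasureTheory.volume)
      (f := f) (g := fun w => f₁ (s * w)) hz.1.le
      (hf.intervalIntegrable_Icc_zero_one (by simp) ⟨hz.1.le, hz.2⟩)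
      (MonotoneOn.intervalIntegrable (fun a ha b hb hab => by
        rw [uIcc_of_le hz.1.le] at ha hb
        exact hf₁ (hscale a ha) (hscale b hb) (mul_le_mul_of_nonneg_left hab hs.1.le)))
      (fun w hw => hff₁ w ⟨hw.1, hw.2.trans hz.2⟩)
    rwa [intervalIntegral.integral_comp_mul_left _ hs.1.ne', mul_zero, smul_eq_mul] at h
  unfold scalarPotential at hU ⊢
  by_cases hcase : s * ∫ w in (0 : ℝ)..g x, f₁ w ≤ ∫ w in (0 : ℝ)..s * g x, f₁ w
  · have h0 := hf₁.primitive_scaling_nonpos hs hz (fun a ha => by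
      -- Small enough for stability to give `f₁ (g b) < b ≤ a`, and for `g b ≤ b` to lie below `s *
      -- g x`.
      let b := min (min a (u / 2)) (min 1 (s * g x / 2))
      have hb0 : 0 < b := by
        refine lt_min (lt_min ha (by linarith)) (lt_min one_pos (by linarith))
      have hba : b ≤ a := (min_le_left _ _).trans (min_le_left _ _)
      have hbu : b ≤ u / 2 := (min_le_left _ _).trans (min_le_right _ _)
      have hb1 : b ≤ 1 := (min_le_right _ _).trans (min_le_left _ _)
      have hbs : b ≤ s * g x / 2 := (min_le_right _ _).trans (min_le_right _ _)
      refine ⟨g b, ⟨hgpos b ⟨hb0, hb1⟩, ?_⟩, (hstable b ⟨hb0, by linarith⟩).trans_le hba⟩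
      linarith [hgle b ⟨hb0.le, hb1⟩]) hcase
    have h1 := hg.integral_lt_mul hx
    have h2 := mul_le_mul_of_nonneg_left h0 (inv_nonneg.2 hs.1.le)
    linarith
  · have h1 := (inv_mul_lt_iff₀ hs.1).2 (not_le.1 hcase)
    linarith

theorem continuousOn_scalarPotential (hf : MonotoneOn f (Icc 0 1)) (hg : MonotoneOn g (Icc 0 1))
    (hgc : Continuous g) (hgm : MapsTo g (Icc 0 1) (Icc 0 1)) :
    ContinuousOn (scalarPotential f g) (Icc 0 1) :=
  ((continuousOn_id.mul hgc.continuousOn).sub hg.continuousOn_primitive).sub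
    (hf.continuousOn_primitive.comp hgc.continuousOn hgm)

end Potential

/-! ### The coupled recursion -/

section Coupled

/-- As `a` lives on `[1, L]`, a shift by `k ≤ m` stays inside `[1, L + m]`, so no boundary terms
appear. -/
theorem sum_Icc_shift {L m k : ℕ} (hk : k ≤ m) (b a : ℤ → ℝ)
    (ha : ∀ t, ¬ (1 ≤ t ∧ t ≤ (L : ℤ)) → a t = 0) :
    ∑ i ∈ Finset.Icc (1 : ℤ) (L + m), b i * a (i - k) =
      ∑ t ∈ Finset.Icc (1 : ℤ) L, b (t + k) * a t := by
  symm
  calc ∑ t ∈ Finset.Icc (1 : ℤ) L, b (t + k) * a t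
      = ∑ i ∈ (Finset.Icc (1 : ℤ) L).map (addRightEmbedding (k : ℤ)), b i * a (i - k) := by
        rw [Finset.sum_map]
        simp only [addRightEmbedding_apply, add_sub_cancel_right]
    _ = _ := by
        refine Finset.sum_subset (fun i hi => ?_) fun i _ hi => ?_
        · simp only [Finset.mem_map, Finset.mem_Icc, addRightEmbedding_apply] at hi ⊢
          obtain ⟨t, ht, rfl⟩ := hi
          omega
        · rw [ha, mul_zero]
          rintro ⟨h1, h2⟩
          exact hi (Finset.mem_map.2 ⟨i - k, Finset.mem_Icc.2 ⟨h1, h2⟩, by simp⟩)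

theorem sum_Icc_sub_telescope (a : ℤ → ℝ) (n : ℕ) :
    ∑ t ∈ Finset.Icc (1 : ℤ) n, (a t - a (t - 1)) = a n - a 0 := by
  induction n with
  | zero => simp
  | succ n ih =>
    have : Finset.Icc (1 : ℤ) (n + 1 : ℕ) = insert ((n : ℤ) + 1) (Finset.Icc (1 : ℤ) n) := by
      ext i
      simp only [Finset.mem_insert, Finset.mem_Icc]
      push_cast
      omega
    rw [this, Finset.sum_insert (by simp), ih]
    push_cast
    simp

/-- Average over the window `t - m, …, t`. -/
noncomputable def avgBack (m : ℕ) (p : ℤ → ℝ) (t : ℤ) : ℝ :=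
  (1 / ((m : ℝ) + 1)) * ∑ k ∈ Finset.range (m + 1), p (t - k)

/-- Average over the window `t, …, t + m`. -/
noncomputable def avgFwd (m : ℕ) (p : ℤ → ℝ) (t : ℤ) : ℝ :=
  (1 / ((m : ℝ) + 1)) * ∑ j ∈ Finset.range (m + 1), p (t + j)

theorem window_le_of_forall_le {m : ℕ} {p : ℕ → ℝ} {c : ℝ} (h : ∀ k ∈ Finset.range (m + 1), p k ≤ c) :
    (1 / ((m : ℝ) + 1)) * ∑ k ∈ Finset.range (m + 1), p k ≤ c := by
  rw [one_div_mul_eq_div, div_le_iff₀ (by positivity)]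
  simpa [mul_comm] using Finset.sum_le_sum h

theorem window_mono {m : ℕ} {p p' : ℕ → ℝ} (h : ∀ k, p k ≤ p' k) :
    (1 / ((m : ℝ) + 1)) * ∑ k ∈ Finset.range (m + 1), p k ≤
      (1 / ((m : ℝ) + 1)) * ∑ k ∈ Finset.range (m + 1), p' k :=
  mul_le_mul_of_nonneg_left (Finset.sum_le_sum fun k _ => h k) (by positivity)

theorem window_nonneg {m : ℕ} {p : ℕ → ℝ} (h : ∀ k, 0 ≤ p k) :
    0 ≤ (1 / ((m : ℝ) + 1)) * ∑ k ∈ Finset.range (m + 1), p k :=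
  mul_nonneg (by positivity) (Finset.sum_nonneg fun k _ => h k)

theorem window_const (m : ℕ) (c : ℝ) :
    (1 / ((m : ℝ) + 1)) * ∑ _k ∈ Finset.range (m + 1), c = c := by
  have : ((m : ℝ) + 1) ≠ 0 := by positivity
  simp only [Finset.sum_const, Finset.card_range, nsmul_eq_mul]
  push_cast
  field_simp

/-- Neighbouring windows differ only in their two end terms. -/
theorem avgFwd_sub_le {m : ℕ} {r : ℤ → ℝ} (hr : ∀ i, r i ∈ Icc (0 : ℝ) 1) (t : ℤ) :
    avgFwd m r t - avgFwd m r (t - 1) ≤ 1 / ((m : ℝ) + 1) := by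
  have h : ∑ j ∈ Finset.range (m + 1), r (t + j) - ∑ j ∈ Finset.range (m + 1), r (t - 1 + j) =
      r (t + m) - r (t - 1) := by
    rw [← Finset.sum_sub_distrib]
    have := Finset.sum_range_sub (fun j : ℕ => r (t - 1 + j)) (m + 1)
    rw [show t + (m : ℤ) = t - 1 + ((m + 1 : ℕ) : ℤ) by push_cast; ring]
    rw [show r (t - 1) = r (t - 1 + ((0 : ℕ) : ℤ)) by simp, ← this]
    refine Finset.sum_congr rfl fun j _ => ?_
    push_cast
    congr 2
    ring
  unfold avgFwd
  rw [← mul_sub, h]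
  refine mul_le_of_le_one_right (by positivity) ?_
  linarith [(hr (t + m)).2, (hr (t - 1)).1]

variable {f g : ℝ → ℝ}

/-- A monotone profile below its own coupled update has potential at most `1 / (m + 1)` at its
plateau. -/
theorem scalarPotential_le_of_subsolution (hf : MonotoneOn f (Icc 0 1))
    (hfm : MapsTo f (Icc 0 1) (Icc 0 1)) (hg : MonotoneOn g (Icc 0 1))
    (hgm : MapsTo g (Icc 0 1) (Icc 0 1)) (hg0 : g 0 = 0) {m L : ℕ} {z : ℤ → ℝ} (hz : Monotone z)
    (hz01 : ∀ t, z t ∈ Icc (0 : ℝ) 1) (hz0 : ∀ t ≤ 0, z t = 0) (hzL : ∀ t, (L : ℤ) ≤ t → z t = z L)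
    (hsub : ∀ t, z t ≤ avgFwd m (fun i => f (avgBack m (fun t => g (z t)) i)) t) :
    scalarPotential f g (z L) ≤ 1 / ((m : ℝ) + 1) := by
  set p : ℤ → ℝ := fun t => g (z t) with hp
  set v : ℤ → ℝ := avgBack m p with hv
  set r : ℤ → ℝ := fun i => f (v i) with hr
  set W : ℝ → ℝ := fun x => x * g x - ∫ w in (0 : ℝ)..x, g w with hWdef
  set Φ : ℝ → ℝ := fun x => ∫ w in (0 : ℝ)..x, f w with hΦdef
  have hp01 : ∀ t, p t ∈ Icc (0 : ℝ) 1 := fun t => hgm (hz01 t)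
  have hpmono : Monotone p := fun a b hab => hg (hz01 a) (hz01 b) (hz hab)
  have hv01 : ∀ i, v i ∈ Icc (0 : ℝ) 1 := fun i =>
    ⟨window_nonneg fun k => (hp01 _).1, window_le_of_forall_le fun k _ => (hp01 _).2⟩
  have hvmono : Monotone v := fun a b hab => window_mono fun k => hpmono (by omega)
  have hr01 : ∀ i, r i ∈ Icc (0 : ℝ) 1 := fun i => hfm (hv01 i)
  have hW : ∀ t, W (z t) - W (z (t - 1)) ≤ z t * (p t - p (t - 1)) := fun t => by
    have hle : z (t - 1) ≤ z t := hz (by omega)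
    have e1 := hg.mul_sub_le_integral (hz01 (t - 1)).1 hle (hz01 t).2
    have e2 := hg.primitive_sub (hz01 (t - 1)) (hz01 t)
    simp only [hWdef, hp]
    linarith
  -- The left endpoint makes this a lower Riemann sum for `∫ f`; it causes the index shift paid for
  -- in `hdiff`.
  have hΦ : ∀ i, r (i - 1) * (v i - v (i - 1)) ≤ Φ (v i) - Φ (v (i - 1)) := fun i => by
    have hle : v (i - 1) ≤ v i := hvmono (by omega)
    have e1 := hf.mul_sub_le_integral (hv01 (i - 1)).1 hle (hv01 i).2
    have e2 := hf.primitive_sub (hv01 (i - 1)) (hv01 i)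
    simp only [hΦdef, hr]
    linarith
  have hdp : ∀ t, ¬ (1 ≤ t ∧ t ≤ (L : ℤ)) → p t - p (t - 1) = 0 := fun t ht => by
    simp only [hp]
    rcases lt_or_ge t 1 with h | h
    · rw [hz0 t (by omega), hz0 (t - 1) (by omega), sub_self]
    · rw [hzL t (by omega), hzL (t - 1) (by omega), sub_self]
  have hdv : ∀ i, v i - v (i - 1) =
      (1 / ((m : ℝ) + 1)) * ∑ k ∈ Finset.range (m + 1), (p (i - k) - p (i - k - 1)) := fun i => by
    simp only [hv, avgBack]
    rw [← mul_sub, ← Finset.sum_sub_distrib]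
    congr 1
    refine Finset.sum_congr rfl fun k _ => ?_
    congr 2
    ring
  have hvL : v ((L + m : ℕ) : ℤ) = g (z L) := by
    rw [← window_const m (g (z L))]
    simp only [hv, avgBack, hp]
    congr 1
    refine Finset.sum_congr rfl fun k hk => ?_
    rw [hzL]
    have := Finset.mem_range.1 hk
    omega
  have hv0 : v 0 = 0 := by
    rw [← window_const m 0]
    simp only [hv, avgBack, hp]
    congr 1
    refine Finset.sum_congr rfl fun k hk => ?_
    rw [hz0 _ (by omega), hg0]
  have hsumW : W (z L) ≤ ∑ t ∈ Finset.Icc (1 : ℤ) L, z t * (p t - p (t - 1)) := by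
    have h := sum_Icc_sub_telescope (fun t => W (z t)) L
    have h0 : W (z 0) = 0 := by simp [hWdef, hz0 0 le_rfl]
    simp only [h0, sub_zero] at h
    rw [← h]
    exact Finset.sum_le_sum fun t _ => hW t
  -- Adjointness: `v` is the backward average of `p`, so exchanging the sums moves the average onto
  -- `r` as a forward one.
  have hsumΦ : ∑ t ∈ Finset.Icc (1 : ℤ) L, avgFwd m r (t - 1) * (p t - p (t - 1)) ≤ Φ (g (z L)) := by
    have h := sum_Icc_sub_telescope (fun i => Φ (v i)) (L + m)
    have h0 : Φ (v 0) = 0 := by simp [hΦdef, hv0]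
    simp only [h0, sub_zero, hvL] at h
    rw [← h]
    refine le_trans (le_of_eq ?_) (Finset.sum_le_sum fun i _ => hΦ i)
    have h1 : ∀ i, r (i - 1) * (v i - v (i - 1)) = (1 / ((m : ℝ) + 1)) *
        ∑ k ∈ Finset.range (m + 1), r (i - 1) * (p (i - k) - p (i - k - 1)) := fun i => by
      rw [hdv, ← Finset.mul_sum]
      ring
    simp only [h1, avgFwd]
    rw [← Finset.mul_sum, Finset.sum_comm]
    push_cast
    rw [Finset.sum_congr rfl fun k hk => sum_Icc_shift
      (Nat.lt_succ_iff.1 (Finset.mem_range.1 hk)) (fun i => r (i - 1))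
      (fun t => p t - p (t - 1)) hdp, Finset.sum_comm, Finset.mul_sum]
    refine Finset.sum_congr rfl fun t _ => ?_
    rw [mul_assoc, Finset.sum_mul]
    congr 1
    refine Finset.sum_congr rfl fun k _ => ?_
    congr 2
    ring
  -- The sole source of the error `1 / (m + 1)`. It multiplies the increments of `p`, whose total is
  -- at most 1, so `L` drops out.
  have hdiff : ∀ t ∈ Finset.Icc (1 : ℤ) L, (z t - avgFwd m r (t - 1)) * (p t - p (t - 1)) ≤
      (1 / ((m : ℝ) + 1)) * (p t - p (t - 1)) := fun t _ =>
    mul_le_mul_of_nonneg_right (by linarith [hsub t, avgFwd_sub_le (m := m) hr01 t])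
      (sub_nonneg.2 (hpmono (by omega)))
  have hfinal := Finset.sum_le_sum hdiff
  rw [← Finset.mul_sum, sum_Icc_sub_telescope p L] at hfinal
  simp only [sub_mul, Finset.sum_sub_distrib] at hfinal
  have hbound : (1 / ((m : ℝ) + 1)) * (p L - p 0) ≤ 1 / ((m : ℝ) + 1) :=
    mul_le_of_le_one_right (by positivity) (by linarith [(hp01 L).2, (hp01 0).1])
  have : scalarPotential f g (z L) = W (z L) - Φ (g (z L)) := rfl
  linarith

/-- The running maximum of a fixed point of the coupled recursion is a monotone profile below its
own coupled update, so the potential at the maximum of the fixed point is at most `1 / (m + 1)`. -/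
theorem exists_le_scalarPotential_le (hf : MonotoneOn f (Icc 0 1))
    (hfm : MapsTo f (Icc 0 1) (Icc 0 1)) (hg : MonotoneOn g (Icc 0 1))
    (hgm : MapsTo g (Icc 0 1) (Icc 0 1)) (hg0 : g 0 = 0) {m L : ℕ} {x : ℤ → ℝ}
    (hx01 : ∀ t, x t ∈ Icc (0 : ℝ) 1) (hx0 : ∀ t, ¬ (1 ≤ t ∧ t ≤ (L : ℤ)) → x t = 0)
    (hfix : ∀ t, 1 ≤ t ∧ t ≤ (L : ℤ) →
      x t = avgFwd m (fun i => f (avgBack m (fun t => g (x t)) i)) t) :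
    ∃ M ∈ Icc (0 : ℝ) 1, (∀ t, x t ≤ M) ∧ M ≤ f (g M) ∧
      scalarPotential f g M ≤ 1 / ((m : ℝ) + 1) := by
  set z : ℤ → ℝ := fun t => ⨆ s : Iic t, x (s : ℤ) with hz
  have hbdd : ∀ t : ℤ, BddAbove (range fun s : Iic t => x (s : ℤ)) := fun t =>
    ⟨1, forall_mem_range.2 fun s => (hx01 s).2⟩
  have hxz : ∀ {s t : ℤ}, s ≤ t → x s ≤ z t := fun {s t} hst =>
    le_ciSup (hbdd t) (⟨s, hst⟩ : Iic t)
  have hzle : ∀ {t : ℤ} {c : ℝ}, (∀ s ≤ t, x s ≤ c) → z t ≤ c := fun {t c} h =>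
    haveI : Nonempty (Iic t) := ⟨⟨t, self_mem_Iic⟩⟩
    ciSup_le fun s => h s s.2
  have hzmono : Monotone z := fun a b hab => hzle fun s hs => hxz (hs.trans hab)
  have hz01 : ∀ t, z t ∈ Icc (0 : ℝ) 1 := fun t =>
    ⟨(hx01 t).1.trans (hxz le_rfl), hzle fun s _ => (hx01 s).2⟩
  have hz0 : ∀ t ≤ 0, z t = 0 := fun t ht =>
    le_antisymm (hzle fun s hs => (hx0 s (by omega)).le) (hz01 t).1
  have hxL : ∀ t, x t ≤ z L := fun t => by
    rcases le_or_gt t L with h | h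
    · exact hxz h
    · rw [hx0 t (by omega)]
      exact (hz01 L).1
  have hzL : ∀ t, (L : ℤ) ≤ t → z t = z L := fun t ht =>
    le_antisymm (hzle fun s _ => hxL s) (hzmono ht)
  have hgback : ∀ {y : ℤ → ℝ}, (∀ t, y t ∈ Icc (0 : ℝ) 1) → ∀ i,
      avgBack m (fun t => g (y t)) i ∈ Icc (0 : ℝ) 1 := fun {y} hy i =>
    ⟨window_nonneg fun k => (hgm (hy _)).1, window_le_of_forall_le fun k _ => (hgm (hy _)).2⟩
  have hsub : ∀ t, z t ≤ avgFwd m (fun i => f (avgBack m (fun t => g (z t)) i)) t := fun t => by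
    -- For `s ≤ t`, each entry of the window at `s` is dominated by the running maximum at the
    -- corresponding entry of the window at `t`.
    refine hzle fun s hs => ?_
    by_cases hsL : 1 ≤ s ∧ s ≤ (L : ℤ)
    · rw [hfix s hsL]
      refine window_mono fun j => hf (hgback hx01 _) (hgback hz01 _) (window_mono fun k => ?_)
      exact hg (hx01 _) (hz01 _) (hxz (by omega))
    · rw [hx0 s hsL]
      exact window_nonneg fun j => (hfm (hgback hz01 _)).1
  refine ⟨z L, hz01 L, hxL, (hsub L).trans ?_,
    scalarPotential_le_of_subsolution hf hfm hg hgm hg0 hzmono hz01 hz0 hzL hsub⟩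
  refine window_le_of_forall_le fun j _ => hf (hgback hz01 _) (hgm (hz01 L)) ?_
  refine window_le_of_forall_le fun k _ => hg (hz01 _) (hz01 L) ?_
  exact hzle fun s _ => hxL s

end Coupled

/-! ### Threshold saturation -/

namespace GSCPCC

theorem parity_erasure_mem_Icc {ρ ε : ℝ} (hρ : ρ ∈ Icc (0 : ℝ) 1) (hε : ε ∈ Icc (0 : ℝ) 1) :
    1 - (1 - ε) * ρ ∈ Icc (0 : ℝ) 1 := by
  obtain ⟨h1, h2⟩ := hρ
  obtain ⟨h3, h4⟩ := hε
  constructor <;> nlinarith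

theorem f_mem_Icc (E : RSCEncoder) {ρ ε z : ℝ} (hρ : ρ ∈ Icc (0 : ℝ) 1) (hε : ε ∈ Icc (0 : ℝ) 1)
    (hz : z ∈ Icc (0 : ℝ) 1) : f E ρ z ε ∈ Icc (0 : ℝ) 1 :=
  E.transfer_mem_Icc ⟨mul_nonneg hε.1 hz.1, mul_le_one₀ hε.2 hz.1 hz.2⟩
    (parity_erasure_mem_Icc hρ hε)

/-- Comparing only the products allows `z' < z`: slack in `ε` is traded for a smaller argument. -/
theorem f_le_f (E : RSCEncoder) {ρ ε ε' z z' : ℝ} (hρ : ρ ∈ Icc (0 : ℝ) 1)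
    (hε : ε ∈ Icc (0 : ℝ) 1) (hε' : ε' ∈ Icc (0 : ℝ) 1) (hεε' : ε ≤ ε') (hz : 0 ≤ z) (hz' : z' ∈ Icc (0 : ℝ) 1)
    (hzz' : ε * z ≤ ε' * z') : f E ρ z ε ≤ f E ρ z' ε' :=
  E.transfer_mono (mul_nonneg hε.1 hz) hzz' (mul_le_one₀ hε'.2 hz'.1 hz'.2)
    (parity_erasure_mem_Icc hρ hε).1 (by nlinarith [hρ.1]) (parity_erasure_mem_Icc hρ hε').2

theorem monotoneOn_f (E : RSCEncoder) {ρ ε : ℝ} (hρ : ρ ∈ Icc (0 : ℝ) 1)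
    (hε : ε ∈ Icc (0 : ℝ) 1) : MonotoneOn (fun z => f E ρ z ε) (Icc 0 1) := fun _ ha _ hb hab =>
  f_le_f E hρ hε hε le_rfl ha.1 hb (mul_le_mul_of_nonneg_left hab hε.1)

/-! ### The repetition map `g` -/

section RepetitionMap

variable {q : ℕ} {lam : ℝ}

theorem mul_mem_Icc_of_repetition (hq : 1 ≤ q) (hlam : lam ∈ Icc (0 : ℝ) (1 / (q : ℝ))) :
    (q : ℝ) * lam ∈ Icc (0 : ℝ) 1 := by
  have hq0 : (0 : ℝ) < q := by exact_mod_cast hq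
  refine ⟨mul_nonneg hq0.le hlam.1, ?_⟩
  have := (le_div_iff₀ hq0).1 hlam.2
  linarith

theorem g_zero (hq : 1 ≤ q) : g q lam 0 = 0 := by
  simp [g, zero_pow (show 2 * q - 1 ≠ 0 by omega)]

theorem g_le_self (hq : 1 ≤ q) (hlam : lam ∈ Icc (0 : ℝ) (1 / (q : ℝ))) {x : ℝ}
    (hx : x ∈ Icc (0 : ℝ) 1) : g q lam x ≤ x := by
  have h := (mul_mem_Icc_of_repetition hq hlam).1
  have hpow : x ^ (2 * q - 1) ≤ x := pow_le_of_le_one hx.1 hx.2 (by omega)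
  unfold g
  nlinarith [mul_le_mul_of_nonneg_left hpow h]

theorem strictMonoOn_g (hq : 1 ≤ q) (hlam : lam ∈ Icc (0 : ℝ) (1 / (q : ℝ))) :
    StrictMonoOn (g q lam) (Icc 0 1) := fun a ha b hb hab => by
  obtain ⟨h0, h1⟩ := mul_mem_Icc_of_repetition hq hlam
  have hpow : a ^ (2 * q - 1) < b ^ (2 * q - 1) := pow_lt_pow_left₀ hab ha.1 (by omega)
  unfold g
  rcases h0.eq_or_lt with h | h
  · rw [← h]
    linarith
  · nlinarith [mul_lt_mul_of_pos_left hpow h, mul_le_mul_of_nonneg_left hab.le (sub_nonneg.2 h1)]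

theorem mapsTo_g (hq : 1 ≤ q) (hlam : lam ∈ Icc (0 : ℝ) (1 / (q : ℝ))) :
    MapsTo (g q lam) (Icc 0 1) (Icc 0 1) := fun x hx =>
  ⟨g_zero (lam := lam) hq ▸ (strictMonoOn_g hq hlam).monotoneOn (by simp) hx hx.1,
    (g_le_self hq hlam hx).trans hx.2⟩

theorem continuous_g : Continuous (g q lam) := by
  unfold g
  fun_prop

end RepetitionMap

/-! ### Potential and stability at the threshold -/

theorem U_eq_scalarPotential (E : RSCEncoder) (q : ℕ) (lam ρ x ε : ℝ) :
    U E q lam ρ x ε = scalarPotential (fun z => f E ρ z ε) (g q lam) x := rfl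

theorem minUnstable_le_one (E : RSCEncoder) (q : ℕ) (lam ρ ε : ℝ) :
    minUnstable E q lam ρ ε ≤ 1 :=
  Real.sSup_le (fun _ h => h.1.2) zero_le_one

theorem f_g_lt_of_lt_minUnstable (E : RSCEncoder) {q : ℕ} {lam ρ ε x : ℝ} (hx : 0 < x)
    (hxu : x < minUnstable E q lam ρ ε) : f E ρ (g q lam x) ε < x := by
  have hne : {x' : ℝ | x' ∈ Icc (0 : ℝ) 1 ∧
      ∀ x ∈ Ioo 0 x', f E ρ (g q lam x) ε < x}.Nonempty :=
    ⟨0, by simp, fun x hx => absurd hx.1 hx.2.not_gt⟩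
  obtain ⟨x', hx', hlt⟩ := exists_lt_of_lt_csSup hne hxu
  exact hx'.2 x ⟨hx, hlt⟩

end GSCPCC

open GSCPCC in
theorem theorem1 (E : RSCEncoder) (q : ℕ) (hq : 1 ≤ q)
    (lam : ℝ) (hlam : lam ∈ Set.Icc (0 : ℝ) (1 / (q : ℝ)))
    (ρ : ℝ) (hρ : ρ ∈ Set.Icc (0 : ℝ) 1)
    (ε : ℝ) (hε : ε ∈ Set.Icc (0 : ℝ) 1)
    (hεc : ε < GSCPCC.potentialThreshold E q lam ρ) :
    ∃ m₀ : ℕ, ∀ m : ℕ, m₀ ≤ m → ∀ L : ℕ,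
      ∀ x : ℤ → ℝ, (∀ t, x t ∈ Set.Icc (0 : ℝ) 1) →
        (Function.IsFixedPt (GSCPCC.coupledStep E q lam ρ ε m L) x ↔ x = 0) := by
  obtain ⟨ε', ⟨hε', hU', hu⟩, hlt⟩ : ∃ ε' ∈ {ε : ℝ | ε ∈ Icc (0 : ℝ) 1 ∧
      (∀ x ∈ Icc (minUnstable E q lam ρ ε) 1, 0 ≤ U E q lam ρ x ε) ∧
      0 < minUnstable E q lam ρ ε}, ε < ε' := by
    refine exists_lt_of_lt_csSup (nonempty_iff_ne_empty.2 fun h => ?_) hεc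
    rw [potentialThreshold, h, Real.sSup_empty] at hεc
    exact absurd hεc (not_lt.2 hε.1)
  set u := minUnstable E q lam ρ ε' with hudef
  have hu1 : u ≤ 1 := minUnstable_le_one E q lam ρ ε'
  have hε'0 : 0 < ε' := hε.1.trans_lt hlt
  obtain ⟨s, hs, hεs⟩ : ∃ s ∈ Ioo (0 : ℝ) 1, ε ≤ ε' * s := by
    -- Here `ε' * s` is the midpoint of `ε` and `ε'`; the ratio `ε / ε'` would vanish at `ε = 0`.
    refine ⟨(ε + ε') / (2 * ε'), ⟨by have := hε.1; positivity, ?_⟩, ?_⟩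
    · rw [div_lt_one (by positivity)]
      linarith
    · have : ε' * ((ε + ε') / (2 * ε')) = (ε + ε') / 2 := by field_simp
      rw [this]
      linarith
  have hf := monotoneOn_f E hρ hε
  have hfm : MapsTo (fun z => f E ρ z ε) (Icc 0 1) (Icc 0 1) := fun z hz => f_mem_Icc E hρ hε hz
  have hg := strictMonoOn_g hq hlam
  have hgm := mapsTo_g hq hlam
  have hg0 : g q lam 0 = 0 := g_zero hq
  have hstable : ∀ x ∈ Ioo 0 u, f E ρ (g q lam x) ε' < x := fun x hx =>
    f_g_lt_of_lt_minUnstable E hx.1 hx.2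
  have hstableε : ∀ x ∈ Ioo 0 u, f E ρ (g q lam x) ε < x := fun x hx => by
    have hgx := hgm ⟨hx.1.le, hx.2.le.trans hu1⟩
    exact (f_le_f E hρ hε hε' hlt.le hgx.1 hgx
      (mul_le_mul_of_nonneg_right hlt.le hgx.1)).trans_lt (hstable x hx)
  have hpos : ∀ x ∈ Icc u 1, 0 < scalarPotential (fun z => f E ρ z ε) (g q lam) x := fun x hx =>
    scalarPotential_pos hf (monotoneOn_f E hρ hε') hs
      (fun z hz => f_le_f E hρ hε hε' hlt.le hz.1
        ⟨mul_nonneg hs.1.le hz.1, mul_le_one₀ hs.2.le hz.1 hz.2⟩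
        (by rw [← mul_assoc]; exact mul_le_mul_of_nonneg_right hεs hz.1))
      hg hg0 (fun x hx => g_le_self hq hlam hx) hu hstable ⟨hu.trans_le hx.1, hx.2⟩
      (U_eq_scalarPotential E q lam ρ x ε' ▸ hU' x hx)
  obtain ⟨w, hw, hmin⟩ := isCompact_Icc.exists_isMinOn (nonempty_Icc.2 hu1)
    ((continuousOn_scalarPotential hf hg.monotoneOn continuous_g hgm).mono
      (Icc_subset_Icc_left hu.le))
  obtain ⟨m₀, hm₀⟩ := exists_nat_one_div_lt (hpos w hw)
  -- Needed for `0` to be a fixed point; monotonicity and stability squeeze `f` at 0 below every `a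
  -- > 0`.
  have hf0 : f E ρ 0 ε = 0 := by
    refine le_antisymm (le_of_forall_gt_imp_ge_of_dense fun a ha => ?_) (hfm (by simp)).1
    have hb0 : 0 < min a (u / 2) := lt_min ha (by linarith)
    have hbu : min a (u / 2) < u := (min_le_right _ _).trans_lt (by linarith)
    have hgb := hgm ⟨hb0.le, hbu.le.trans hu1⟩
    exact (hf (by simp) hgb hgb.1).trans ((hstableε _ ⟨hb0, hbu⟩).le.trans (min_le_left _ _))
  refine ⟨m₀, fun m hm L x hx => ⟨fun hfix => ?_, ?_⟩⟩
  · have hx0 : ∀ t, ¬ (1 ≤ t ∧ t ≤ (L : ℤ)) → x t = 0 := fun t ht => by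
      rw [← congrFun hfix t, coupledStep, if_neg ht]
    obtain ⟨M, hM, hxM, hMf, hMU⟩ := exists_le_scalarPotential_le hf hfm hg.monotoneOn hgm hg0 hx hx0
      (m := m) (fun t ht => by
        conv_lhs => rw [← congrFun hfix t, coupledStep, if_pos ht]
        rfl)
    rcases hM.1.eq_or_lt with h0 | h0
    · funext t
      exact le_antisymm ((hxM t).trans h0.ge) (hx t).1
    · have huM : u ≤ M := by
        by_contra h
        exact absurd hMf (not_le.2 (hstableε M ⟨h0, not_le.1 h⟩))
      have h1 := isMinOn_iff.1 hmin M ⟨huM, hM.2⟩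
      have h2 : 1 / ((m : ℝ) + 1) ≤ 1 / ((m₀ : ℝ) + 1) :=
        one_div_le_one_div_of_le (by positivity) (by exact_mod_cast Nat.succ_le_succ hm)
      linarith
  · rintro rfl
    funext t
    simp [coupledStep, hg0, hf0]
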